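/- Let $\mathbb T=\mathbb R\cup\mathbb R^{\nu}\cup\{-\infty\}$ be the extended tropical semiring, where $\mathbb R^\nu=\{a^\nu : a\in\mathbb R\}$ is a second (ghost) copy of the reals. Order $\mathbb T$ totally by $-\infty\prec x$ for all $x\neq-\infty$, by $a,a^\nu\prec b,b^\nu$ whenever $a<b$ are real, and by $a\prec a^\nu$. Addition is $x\oplus y=\max_\prec\{x,y\}$ if $x\ne y$, $a\oplus a=a^\nu\oplus a^\nu=a^\nu$, and $(-\infty)\oplus(-\infty)=-\infty$; multiplication is $a\odot b=a+b$, $a^\nu\odot b=a\odot b^\nu=a^\nu\odot b^\nu=(a+b)^\nu$, with $-\infty$ absorbing. Vectors $v_1,\dots,v_k\in\mathbb T^{(n)}$ are tropically dependent if there are $\alpha_1,\dots,\alpha_k\in\mathbb R\cup\{-\infty\}$, not all $-\infty$, such that every coordinate of $\alpha_1v_1\oplus\cdots\oplus\alpha_kv_k$ lies in $\mathbb R^\nu\cup\{-\infty\}$; otherwise they are tropically independent. The tropical rank $\operatorname{rk}(A)$ of a matrix $A$ over $\mathbb T$ is the maximal number of tropically independent rows of $A$. Columns $c_1,\dots,c_k\in\mathbb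 R^{m}$ of a real matrix are called strongly linearly independent (in Butkovič's sense) if there is $v\in\mathbb R^m$ such that the max-plus linear system $$\max_{1\le j\le k}\,(c_{ij}+x_j)=v_i\qquad(1\le i\le m),$$ where $c_{ij}$ is the $i$-th entry of $c_j$, has exactly one solution $x\in\mathbb R^k$ (for $k=0$ the maximum is read as $-\infty$). **Corollary.** Let $A$ be an $m\times n$ matrix, $n\ge 1$, all of whose entries are real (none is $-\infty$ or a ghost). Then the tropical rank of $A$ equals the largest size of a strongly linearly independent subset of the columns of $A$; in particular, a largest such subset exists. -/

import Mathlib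

/-- The extended tropical semiring `𝕋`: a real copy and a ghost copy of `ℝ`, both enlarged by the
same element `-∞`. Here `real a` is `a` and `ghost a` is `a^ν`. -/
inductive ExtTrop : Type
  | negInf : ExtTrop
  | real (a : ℝ) : ExtTrop
  | ghost (a : ℝ) : ExtTrop

namespace ExtTrop

/-- The position of an element in the order: `-∞` comes first, then pairs are compared
lexicographically, a real `a` being immediately below its ghost `a^ν`. -/
def key : ExtTrop → WithBot (ℝ ×ₗ Bool)
  | negInf => ⊥
  | real a => (toLex (a, false) : ℝ ×ₗ Bool)
  | ghost a => (toLex (a, true) : ℝ ×ₗ Bool)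

theorem key_injective : Function.Injective key := by
  intro x y h
  cases x <;> cases y <;> simp_all [key]

/-- The total order `≺` on `𝕋`. -/
noncomputable instance : LinearOrder ExtTrop := LinearOrder.lift' key key_injective

/-- The ghost map `ν`. -/
def nu : ExtTrop → ExtTrop
  | negInf => negInf
  | real a => ghost a
  | ghost a => ghost a

/-- The sum `x ⊕ y`: the maximum if `x ≠ y`, and `x^ν` if `x = y`. -/
protected noncomputable def add (x y : ExtTrop) : ExtTrop :=
  if x = y then nu x else max x y

/-- The product `x ⊙ y`. -/
protected noncomputable def mul : ExtTrop → ExtTrop → ExtTrop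
  | negInf, _ => negInf
  | _, negInf => negInf
  | real a, real b => real (a + b)
  | real a, ghost b => ghost (a + b)
  | ghost a, real b => ghost (a + b)
  | ghost a, ghost b => ghost (a + b)

noncomputable instance : Add ExtTrop := ⟨ExtTrop.add⟩
noncomputable instance : Mul ExtTrop := ⟨ExtTrop.mul⟩
instance : Zero ExtTrop := ⟨negInf⟩
instance : One ExtTrop := ⟨real 0⟩

theorem le_iff_key (x y : ExtTrop) : x ≤ y ↔ key x ≤ key y := Iff.rfl

theorem add_eq_ite (x y : ExtTrop) :
    x + y = if x = y then nu x else if x ≤ y then y else x := by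
  change ExtTrop.add x y = _
  unfold ExtTrop.add
  rw [max_def]

theorem zero_eq : (0 : ExtTrop) = negInf := rfl

theorem one_eq : (1 : ExtTrop) = real 0 := rfl

theorem negInf_add (x : ExtTrop) : negInf + x = x := by
  cases x <;> simp [add_eq_ite, le_iff_key, key, nu]

theorem add_comm' (x y : ExtTrop) : x + y = y + x := by
  change ExtTrop.add x y = ExtTrop.add y x
  unfold ExtTrop.add
  rcases eq_or_ne x y with h | h
  · simp [h]
  · rw [if_neg h, if_neg h.symm, max_comm]

theorem add_negInf (x : ExtTrop) : x + negInf = x := by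
  rw [add_comm', negInf_add]

theorem real_add_real (a b : ℝ) :
    real a + real b = if a < b then real b else if b < a then real a else ghost a := by
  rcases lt_trichotomy a b with h | rfl | h
  · simp [add_eq_ite, le_iff_key, key, nu, Prod.Lex.le_iff, h, h.ne]
  · simp [add_eq_ite, nu]
  · simp [add_eq_ite, le_iff_key, key, nu, Prod.Lex.le_iff, h, h.ne', h.not_gt]

theorem real_add_ghost (a b : ℝ) :
    real a + ghost b = if b < a then real a else ghost b := by
  rcases lt_trichotomy a b with h | rfl | h
  · simp [add_eq_ite, le_iff_key, key, Prod.Lex.le_iff, h, h.not_gt]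
  · simp [add_eq_ite, le_iff_key, key, Prod.Lex.le_iff]
  · simp [add_eq_ite, le_iff_key, key, Prod.Lex.le_iff, h, h.ne', h.not_gt]

theorem ghost_add_real (a b : ℝ) :
    ghost a + real b = if a < b then real b else ghost a := by
  rw [add_comm', real_add_ghost]

theorem ghost_add_ghost (a b : ℝ) :
    ghost a + ghost b = if a < b then ghost b else ghost a := by
  rcases lt_trichotomy a b with h | rfl | h
  · simp [add_eq_ite, le_iff_key, key, nu, Prod.Lex.le_iff, h, h.ne]
  · simp [add_eq_ite, nu]
  · simp [add_eq_ite, le_iff_key, key, nu, Prod.Lex.le_iff, h, h.ne', h.not_gt]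

theorem negInf_mul (x : ExtTrop) : negInf * x = negInf := by cases x <;> rfl
theorem mul_negInf (x : ExtTrop) : x * negInf = negInf := by cases x <;> rfl
theorem real_mul_real (a b : ℝ) : real a * real b = real (a + b) := rfl
theorem real_mul_ghost (a b : ℝ) : real a * ghost b = ghost (a + b) := rfl
theorem ghost_mul_real (a b : ℝ) : ghost a * real b = ghost (a + b) := rfl
theorem ghost_mul_ghost (a b : ℝ) : ghost a * ghost b = ghost (a + b) := rfl

theorem add_assoc' (x y z : ExtTrop) : x + y + z = x + (y + z) := by
  cases x <;> cases y <;> cases z <;>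
    simp only [negInf_add, add_negInf, real_add_real, real_add_ghost, ghost_add_real,
      ghost_add_ghost] <;>
    split_ifs <;>
    simp only [real_add_real, real_add_ghost, ghost_add_real, ghost_add_ghost] <;>
    grind

theorem mul_comm' (x y : ExtTrop) : x * y = y * x := by
  cases x <;> cases y <;>
    simp [negInf_mul, mul_negInf, real_mul_real, real_mul_ghost, ghost_mul_real,
      ghost_mul_ghost, add_comm]

theorem mul_assoc' (x y z : ExtTrop) : x * y * z = x * (y * z) := by
  cases x <;> cases y <;> cases z <;>
    simp [negInf_mul, mul_negInf, real_mul_real, real_mul_ghost, ghost_mul_real,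
      ghost_mul_ghost, add_assoc]

theorem one_mul' (x : ExtTrop) : 1 * x = x := by
  cases x <;> simp [one_eq, mul_negInf, real_mul_real, real_mul_ghost]

theorem mul_add' (x y z : ExtTrop) : x * (y + z) = x * y + x * z := by
  cases x <;> cases y <;> cases z <;>
    simp only [negInf_add, add_negInf, negInf_mul, mul_negInf, real_add_real, real_add_ghost,
      ghost_add_real, ghost_add_ghost, real_mul_real, real_mul_ghost, ghost_mul_real,
      ghost_mul_ghost, add_lt_add_iff_left] <;>
    split_ifs <;>
    simp only [real_mul_real, real_mul_ghost, ghost_mul_real, ghost_mul_ghost] <;>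
    grind

noncomputable instance : CommSemiring ExtTrop where
  add_assoc := add_assoc'
  zero_add := negInf_add
  add_zero := add_negInf
  add_comm := add_comm'
  nsmul := nsmulRec
  mul_assoc := mul_assoc'
  one_mul := one_mul'
  mul_one x := by rw [mul_comm', one_mul']
  mul_comm := mul_comm'
  zero_mul := negInf_mul
  mul_zero := mul_negInf
  left_distrib := mul_add'
  right_distrib x y z := by rw [mul_comm', mul_add', mul_comm' z x, mul_comm' z y]
  npow := npowRec

/-- `ℝ ∪ {-∞}` inside `𝕋`. -/
def realBar : Set ExtTrop := Set.range real ∪ {negInf}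

/-- The ghost part together with `-∞`. -/
def ghostBar : Set ExtTrop := Set.range ghost ∪ {negInf}

/-- A family of vectors `v i`, with coordinates indexed by `κ`, is tropically dependent if some
linear combination with coefficients in `ℝ ∪ {-∞}`, not all equal to `-∞`, is a ghost vector. -/
def TropDependent {ι κ : Type*} [Fintype ι] (v : ι → κ → ExtTrop) : Prop :=
  ∃ α : ι → ExtTrop, (∀ i, α i ∈ realBar) ∧ (∃ i, α i ≠ negInf) ∧
    ∀ j, ∑ i, α i * v i j ∈ ghostBar

/-- Tropical independence is the negation of tropical dependence. -/
def TropIndependent {ι κ : Type*} [Fintype ι] (v : ι → κ → ExtTrop) : Prop :=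
  ¬ TropDependent v

open Classical in
/-- The tropical rank of a matrix over `𝕋`: the maximal number of tropically independent rows. -/
noncomputable def tropicalRank {m n : ℕ} (A : Matrix (Fin m) (Fin n) ExtTrop) : ℕ :=
  (Finset.univ.filter fun I : Finset (Fin m) =>
    TropIndependent fun i : I => A i.1).sup Finset.card

end ExtTrop

/-- The max-plus linear system `A x = v` for real `A`, `x`, `v`: for every row `i` the maximum over
`j` of `a i j + x j` equals `v i` (the maximum over the empty set being `-∞`). -/
def MaxPlusSolves {ι κ : Type*} [Fintype κ] (A : Matrix ι κ ℝ) (x : κ → ℝ) (v : ι → ℝ) : Prop :=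
  ∀ i, (Finset.univ.sup fun j => ((A i j + x j : ℝ) : WithBot ℝ)) = (v i : WithBot ℝ)

/-- The columns of a real matrix are strongly linearly independent if for some real right-hand side
`v` the max-plus system `A x = v` has exactly one real solution `x`. -/
def StronglyLinIndepColumns {ι κ : Type*} [Fintype κ] (A : Matrix ι κ ℝ) : Prop :=
  ∃ v : ι → ℝ, ∃! x : κ → ℝ, MaxPlusSolves A x v

/-! Both kinds of independence reduce to one condition, `DominatedColumns`. A max-plus solution is
unique for a suitable right-hand side when each column is the only maximiser of some row: a column
that never is can be lowered freely. Rows are tropically independent when the transpose is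
dominated. If domination fails, the dichotomy `exists_shift_or_dominatedColumns` supplies a shift
under which every maximum is attained twice, which is a tropical dependence; its proof combines
monotone fixed points with compactness. Domination passes to the transpose of a square submatrix
(`DominatedColumns.exists_rows`), so row families and column families reach the same maximal size.
-/

/-- The columns of a real matrix can be shifted so that each of them is the unique maximiser of
some row. -/
def DominatedColumns {ι κ : Type*} (M : Matrix ι κ ℝ) : Prop :=
  ∃ x : κ → ℝ, ∀ j, ∃ i, ∀ l, l ≠ j → M i l + x l < M i j + x j

/-- Dominated columns contain a square submatrix whose rows are dominated as well. -/
theorem DominatedColumns.exists_rows {ι κ : Type*} [Fintype κ] {M : Matrix ι κ ℝ}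
    (h : DominatedColumns M) :
    ∃ I : Finset ι, I.card = Fintype.card κ ∧
      DominatedColumns (M.submatrix (fun i : I => i.1) id).transpose := by
  classical
  obtain ⟨x, hx⟩ := h
  choose r hr using hx
  have hinj : Function.Injective r := by
    intro j l hjl
    by_contra hne
    have h1 := hr j l (Ne.symm hne)
    have h2 := hr l j hne
    rw [← hjl] at h2
    exact lt_asymm h1 h2
  refine ⟨Finset.univ.image r, Finset.card_image_of_injective _ hinj, ?_⟩
  have hs : ∀ i : (Finset.univ.image r : Finset ι), ∃ j, r j = i.1 := by
    rintro ⟨i, hi⟩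
    simpa using hi
  choose s hs using hs
  -- Each row is shifted by minus its maximum. After both shifts all entries are at most 0, and row
  -- `i` reaches 0 only in column `s i`, so that column peaks at row `i` alone.
  refine ⟨fun i => -(M i.1 (s i) + x (s i)), fun i => ⟨s i, fun l hl => ?_⟩⟩
  have hne : s i ≠ s l := by
    intro h
    exact hl (Subtype.ext (by rw [← hs l, ← hs i, h]))
  have h := hr (s l) (s i) hne
  rw [hs l] at h
  simp only [Matrix.transpose_apply, Matrix.submatrix_apply, id]
  linarith

theorem DominatedColumns.of_submatrix {ι κ ι' : Type*} {M : Matrix ι κ ℝ} (f : ι' → ι)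
    (h : DominatedColumns (M.submatrix f id)) : DominatedColumns M := by
  obtain ⟨x, hx⟩ := h
  refine ⟨x, fun j => ?_⟩
  obtain ⟨i, hi⟩ := hx j
  exact ⟨f i, hi⟩

/-! ### Unique max-plus solvability and domination -/

theorem maxPlusSolves_iff {ι κ : Type*} [Fintype κ] {A : Matrix ι κ ℝ} {x : κ → ℝ} {v : ι → ℝ} :
    MaxPlusSolves A x v ↔
      ∀ i, (∀ j, A i j + x j ≤ v i) ∧ ∃ j, A i j + x j = v i := by
  refine forall_congr' fun i => ⟨fun h => ?_, fun ⟨h1, j, hj⟩ => ?_⟩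
  · refine ⟨fun j => ?_, ?_⟩
    · have := Finset.le_sup (f := fun j => ((A i j + x j : ℝ) : WithBot ℝ)) (Finset.mem_univ j)
      rw [h] at this
      exact WithBot.coe_le_coe.1 this
    · have hne : (Finset.univ : Finset κ).Nonempty := by
        by_contra hne
        rw [Finset.not_nonempty_iff_eq_empty.1 hne, Finset.sup_empty] at h
        exact WithBot.bot_ne_coe h
      obtain ⟨j, -, hj⟩ := Finset.exists_mem_eq_sup _ hne
        (fun j => ((A i j + x j : ℝ) : WithBot ℝ))
      rw [h] at hj
      exact ⟨j, (WithBot.coe_injective hj).symm⟩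
  · apply le_antisymm
    · exact Finset.sup_le fun j _ => WithBot.coe_le_coe.2 (h1 j)
    · rw [← hj]
      exact Finset.le_sup (f := fun j => ((A i j + x j : ℝ) : WithBot ℝ)) (Finset.mem_univ j)

theorem StronglyLinIndepColumns.dominatedColumns {ι κ : Type*} [Fintype κ] {A : Matrix ι κ ℝ}
    (h : StronglyLinIndepColumns A) : DominatedColumns A := by
  classical
  obtain ⟨v, x, hx, huniq⟩ := h
  have hx' := maxPlusSolves_iff.1 hx
  refine ⟨x, fun j => ?_⟩
  by_contra! hcon
  -- If column `j` is nowhere the sole maximiser, lowering `x j` leaves every row maximum attained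
  -- elsewhere.
  have hy : MaxPlusSolves A (Function.update x j (x j - 1)) v := by
    refine maxPlusSolves_iff.2 fun i => ⟨fun l => ?_, ?_⟩
    · have := (hx' i).1 l
      rcases eq_or_ne l j with rfl | hl
      · simp only [Function.update_self]
        linarith
      · rwa [Function.update_of_ne hl]
    · obtain ⟨l, hl⟩ := (hx' i).2
      rcases eq_or_ne l j with rfl | hlj
      · obtain ⟨l', hl', hle⟩ := hcon i
        refine ⟨l', ?_⟩
        rw [Function.update_of_ne hl']
        exact le_antisymm ((hx' i).1 l') (hl ▸ hle)
      · exact ⟨l, by rwa [Function.update_of_ne hlj]⟩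
  have := congrFun (huniq _ hy) j
  simp at this

theorem DominatedColumns.stronglyLinIndepColumns {ι κ : Type*} [Fintype κ] [Nonempty κ]
    {A : Matrix ι κ ℝ} (h : DominatedColumns A) : StronglyLinIndepColumns A := by
  obtain ⟨x, hx⟩ := h
  choose p hp using fun i => Finite.exists_max fun j => A i j + x j
  refine ⟨fun i => A i (p i) + x (p i), x, maxPlusSolves_iff.2 fun i => ⟨hp i, p i, rfl⟩, ?_⟩
  intro y hy
  have hy' := maxPlusSolves_iff.1 hy
  have hle : ∀ j, y j ≤ x j := by
    intro j
    obtain ⟨i, hi⟩ := hx j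
    have hpi : p i = j := by
      by_contra hne
      exact (hi _ hne).not_ge (hp i j)
    have := (hy' i).1 j
    simp only [hpi] at this
    linarith
  funext j
  refine le_antisymm (hle j) ?_
  -- In a row dominated by `j`, the bound `y ≤ x` keeps all other columns below `v i`, so column `j`
  -- must attain it.
  obtain ⟨i, hi⟩ := hx j
  obtain ⟨l, hl⟩ := (hy' i).2
  have h1 := hp i j
  rcases eq_or_ne l j with rfl | hne
  · linarith
  · have := hi l hne
    have := hle l
    linarith

/-! ### The dichotomy for shifts of a real matrix -/

/-- Either the columns of `M` can be shifted so that in each row the maximum is attained twice, or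
they can be shifted so that each column is the unique maximiser of some row. -/
theorem exists_shift_or_dominatedColumns {ι κ : Type*} [Fintype ι] [Nonempty ι] [Fintype κ]
    (M : Matrix ι κ ℝ) :
    (Nonempty κ ∧ ∃ x : κ → ℝ, ∀ i j, ∃ l, l ≠ j ∧ M i j + x j ≤ M i l + x l) ∨
      DominatedColumns M := by
  classical
  rcases isEmpty_or_nonempty κ with hκ | hκ
  · exact Or.inr ⟨fun _ => 0, fun j => (hκ.false j).elim⟩
  refine or_iff_not_imp_right.2 fun hcert => ⟨hκ, ?_⟩
  obtain ⟨D, hD0, hD⟩ : ∃ D : ℝ, 0 < D ∧ ∀ i j l, M i j - M i l ≤ D := by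
    obtain ⟨q, hq⟩ := Finite.exists_max fun q : ι × κ × κ => M q.1 q.2.1 - M q.1 q.2.2
    exact ⟨max 1 (M q.1 q.2.1 - M q.1 q.2.2), by positivity,
      fun i j l => (hq (i, j, l)).trans (le_max_right _ _)⟩
  -- For `γ j ≥ -D`, the inequality `γ j ≤ F j γ` says that `j` is nowhere the sole maximiser. The
  -- value `-(D + 1)` at `l = j` lies below every such `γ j`, so it is never a witness, and it
  -- covers the case of a single column.
  let t : κ → ι → κ → (κ → ℝ) → ℝ := fun j i l γ =>
    if l = j then -(D + 1) else M i l + γ l - M i j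
  let F : κ → (κ → ℝ) → ℝ := fun j γ =>
    Finset.univ.inf' Finset.univ_nonempty fun i : ι =>
      Finset.univ.sup' Finset.univ_nonempty fun l : κ => t j i l γ
  have le_F : ∀ j γ c, c ≤ F j γ ↔ ∀ i, ∃ l, c ≤ t j i l γ := by
    intro j γ c
    simp [F, Finset.le_inf'_iff, Finset.le_sup'_iff]
  have hmono : ∀ j, Monotone (F j) := by
    intro j γ δ hγ
    rw [le_F]
    intro i
    obtain ⟨l, hl⟩ := (le_F j γ _).1 le_rfl i
    refine ⟨l, hl.trans ?_⟩
    have := hγ l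
    simp only [t]
    split_ifs <;> linarith
  have hcont : ∀ j, Continuous (F j) := by
    intro j
    refine Continuous.finset_inf'_apply _ fun i _ => Continuous.finset_sup'_apply _ fun l _ => ?_
    simp only [t]
    split_ifs <;> fun_prop
  let K : Set (κ → ℝ) := Set.Icc (fun _ => -D) (fun _ => 0) ∩ {γ | ∃ l, γ l = 0}
  have hKc : IsCompact K := by
    refine isCompact_Icc.inter_right ?_
    have : {γ : κ → ℝ | ∃ l, γ l = 0} = ⋃ l, {γ | γ l = 0} := by ext; simp
    rw [this]
    exact isClosed_iUnion_of_finite fun l => isClosed_eq (continuous_apply l) continuous_const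
  -- Any fixed point of `F + ε` truncated to `[-D, 0]` serves. Were all its coordinates negative,
  -- then `γ j ≥ F j γ + ε > F j γ` for all `j`, which is domination; `ε` provides the strictness.
  have happrox : ∀ ε : ℝ, 0 < ε → ∃ γ ∈ K, ∀ j, γ j ≤ F j γ + ε := by
    intro ε hε
    have : Fact ((-D : ℝ) ≤ 0) := ⟨by linarith⟩
    let H : (κ → Set.Icc (-D) (0 : ℝ)) →o (κ → Set.Icc (-D) (0 : ℝ)) :=
      { toFun := fun γ j => Set.projIcc (-D) 0 Fact.out (F j (fun l => (γ l : ℝ)) + ε)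
        monotone' := by
          intro γ δ h j
          exact Set.monotone_projIcc _ (by
            have := hmono j (a := fun l => (γ l : ℝ)) (b := fun l => (δ l : ℝ)) fun l => h l
            linarith) }
    let γ := OrderHom.lfp H
    have hfix : ∀ j, (γ j : ℝ) = max (-D) (min 0 (F j (fun l => (γ l : ℝ)) + ε)) := by
      intro j
      have h := congrFun (OrderHom.map_lfp H) j
      conv_lhs => rw [show γ j = H γ j from h.symm]
      rfl
    have hzero : ∃ l, (γ l : ℝ) = 0 := by
      by_contra! hne
      apply hcert
      refine ⟨fun l => (γ l : ℝ), fun j => ?_⟩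
      have hneg : (γ j : ℝ) < 0 := lt_of_le_of_ne (γ j).2.2 (hne j)
      have hlt : ¬ (γ j : ℝ) ≤ F j (fun l => (γ l : ℝ)) := by
        have := hfix j
        intro hle
        rcases le_total 0 (F j (fun l => (γ l : ℝ)) + ε) with h0 | h0
        · rw [min_eq_left h0, max_eq_right (by linarith)] at this
          linarith
        · rw [min_eq_right h0] at this
          have := le_max_right (-D) (F j (fun l => (γ l : ℝ)) + ε)
          linarith
      rw [le_F] at hlt
      push Not at hlt
      obtain ⟨i, hi⟩ := hlt
      refine ⟨i, fun l hl => ?_⟩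
      have := hi l
      simp only [t, if_neg hl] at this
      linarith
    refine ⟨fun l => (γ l : ℝ), ⟨⟨fun l => (γ l).2.1, fun l => (γ l).2.2⟩, hzero⟩, fun j => ?_⟩
    obtain ⟨l, hl⟩ := hzero
    rcases eq_or_ne l j with rfl | hne
    · have := hfix l
      by_contra! hlt
      have hlt' : max (-D) (min 0 (F l (fun l => (γ l : ℝ)) + ε)) < 0 :=
        max_lt (by linarith) (min_lt_of_right_lt (by simpa only [hl] using hlt))
      linarith
    -- The zero coordinate `l` competes with `j` in every row, so the lower truncation is harmless.
    · have hF : -D ≤ F j (fun l => (γ l : ℝ)) := by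
        rw [le_F]
        intro i
        refine ⟨l, ?_⟩
        simp only [t, if_neg hne, hl]
        have := hD i j l
        linarith
      exact (hfix j).trans_le (max_le (by linarith) (min_le_right _ _))
  -- A minimiser of the worst violation `φ` on the compact set `K` removes the `ε`.
  let φ : (κ → ℝ) → ℝ := fun γ => Finset.univ.sup' Finset.univ_nonempty fun j => γ j - F j γ
  have hφ : Continuous φ :=
    Continuous.finset_sup'_apply _ fun j _ => (continuous_apply j).sub (hcont j)
  obtain ⟨γ₁, hγ₁, -⟩ := happrox 1 one_pos
  obtain ⟨γ, hγK, hγ⟩ := hKc.exists_isMinOn ⟨γ₁, hγ₁⟩ hφ.continuousOn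
  have hφ0 : φ γ ≤ 0 := by
    refine le_of_forall_pos_le_add fun ε hε => ?_
    obtain ⟨δ, hδK, hδ⟩ := happrox ε hε
    refine (hγ hδK).trans ?_
    refine Finset.sup'_le _ _ fun j _ => ?_
    linarith [hδ j]
  refine ⟨γ, fun i j => ?_⟩
  have hj : γ j ≤ F j γ := by
    have := (Finset.le_sup' (fun j => γ j - F j γ) (Finset.mem_univ j)).trans hφ0
    linarith
  obtain ⟨l, hl⟩ := (le_F j γ _).1 hj i
  have hlow := hγK.1.1 j
  simp only [t] at hl
  split_ifs at hl with hlj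
  · linarith
  · exact ⟨l, hlj, by linarith⟩

/-! ### Tropical independence of real rows -/

namespace ExtTrop

/-- The absorption `f l + real c = real c` encodes `f l ≺ real c` and is stable under sums. -/
theorem sum_eq_real {ι : Type*} [Fintype ι] {f : ι → ExtTrop} {i : ι} {c : ℝ}
    (hi : f i = real c) (h : ∀ l, l ≠ i → f l + real c = real c) : ∑ l, f l = real c := by
  classical
  rw [← Finset.sum_erase_add _ _ (Finset.mem_univ i), hi]
  refine Finset.sum_induction f (fun y => y + real c = real c) ?_ (negInf_add _) ?_
  · intro a b ha hb
    rw [add_assoc, hb, ha]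
  · intro l hl
    exact h l (Finset.ne_of_mem_erase hl)

theorem sum_real_eq_ghost {ι : Type*} [Fintype ι] {f : ι → ℝ} {i l : ι} (hne : l ≠ i)
    (hl : f l = f i) (h : ∀ p, f p ≤ f i) : ∑ p, real (f p) = ghost (f i) := by
  classical
  rw [← Finset.sum_erase_add _ _ (Finset.mem_univ i),
    ← Finset.sum_erase_add _ _ (Finset.mem_erase.2 ⟨hne, Finset.mem_univ l⟩), add_assoc, hl,
    real_add_real, if_neg (lt_irrefl _), if_neg (lt_irrefl _)]
  refine Finset.sum_induction (fun p => real (f p))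
    (fun y => y + ghost (f i) = ghost (f i)) ?_ (negInf_add _) ?_
  · intro a b ha hb
    rw [add_assoc, hb, ha]
  · intro p _
    rw [real_add_ghost, if_neg (h p).not_gt]

theorem real_notMem_ghostBar (c : ℝ) : real c ∉ ghostBar := by
  rintro (⟨b, hb⟩ | hb) <;> cases hb

/-- Rows of a real matrix are tropically independent exactly if they can be shifted so that each
of them is the unique maximiser of some column. -/
theorem tropIndependent_real_iff {ι κ : Type*} [Fintype ι] [Fintype κ] [Nonempty κ]
    (A : Matrix ι κ ℝ) :
    (TropIndependent fun i j => real (A i j)) ↔ DominatedColumns A.transpose := by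
  constructor
  · intro h
    refine (exists_shift_or_dominatedColumns A.transpose).resolve_left ?_
    rintro ⟨⟨i₀⟩, x, hx⟩
    refine h ⟨fun i => real (x i), fun i => Or.inl ⟨_, rfl⟩, ⟨i₀, nofun⟩, fun j => ?_⟩
    have : Nonempty ι := ⟨i₀⟩
    obtain ⟨i, hi⟩ := Finite.exists_max fun i => x i + A i j
    obtain ⟨l, hl, hle⟩ := hx j i
    simp only [Matrix.transpose_apply] at hle
    have heq : x l + A l j = x i + A i j := le_antisymm (hi l) (by linarith)
    exact Or.inl ⟨_, (sum_real_eq_ghost (f := fun i => x i + A i j) hl heq hi).symm⟩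
  · rintro ⟨x, hx⟩ ⟨α, hα, ⟨i₀, hi₀⟩, hsum⟩
    classical
    choose c hc using hx
    simp only [Matrix.transpose_apply] at hc
    have hα' : ∀ i, α i ≠ negInf → ∃ a, α i = real a := by
      intro i hi
      rcases hα i with ⟨a, ha⟩ | h
      · exact ⟨a, ha.symm⟩
      · exact (hi h).elim
    choose! a ha using hα'
    -- Maximising `a i - x i` makes row `i` win column `c i` strictly under the coefficients `a` as
    -- well, so that coordinate of the sum is real.
    obtain ⟨i, hi, hmax⟩ := Finset.exists_max_image
      (Finset.univ.filter fun i => α i ≠ negInf) (fun i => a i - x i) ⟨i₀, by simpa using hi₀⟩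
    simp only [Finset.mem_filter, Finset.mem_univ, true_and] at hi hmax
    refine real_notMem_ghostBar (a i + A i (c i)) ?_
    rw [← sum_eq_real (f := fun l => α l * real (A l (c i))) (i := i)]
    · exact hsum (c i)
    · simp only [ha i hi, real_mul_real]
    · intro l hl
      by_cases hαl : α l = negInf
      · simp only [hαl, negInf_mul, negInf_add]
      · have h1 := hmax l hαl
        have h2 := hc i l hl
        simp only [ha l hαl, real_mul_real]
        rw [real_add_real, if_pos (by linarith)]

end ExtTrop

/-! ### Equality of the two maximal sizes -/

theorem mainTheorem11 {m n : ℕ} (hn : 0 < n) (A : Matrix (Fin m) (Fin n) ℝ) :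
    IsGreatest
      {k : ℕ | ∃ J : Finset (Fin n), J.card = k ∧
        StronglyLinIndepColumns (A.submatrix id (fun j : J => j.1))}
      (ExtTrop.tropicalRank (A.map ExtTrop.real)) := by
  classical
  have : Nonempty (Fin n) := ⟨⟨0, hn⟩⟩
  have hind : ∀ I : Finset (Fin m),
      (ExtTrop.TropIndependent fun i : I => (A.map ExtTrop.real) i.1) ↔
        DominatedColumns (A.submatrix (fun i : I => i.1) id).transpose := fun I =>
    ExtTrop.tropIndependent_real_iff (A.submatrix (fun i : I => i.1) id)
  have hle : ∀ I : Finset (Fin m),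
      DominatedColumns (A.submatrix (fun i : I => i.1) id).transpose →
        I.card ≤ ExtTrop.tropicalRank (A.map ExtTrop.real) := by
    intro I hI
    unfold ExtTrop.tropicalRank
    exact Finset.le_sup (f := Finset.card)
      (Finset.mem_filter.2 ⟨Finset.mem_univ I, (hind I).2 hI⟩)
  constructor
  · obtain ⟨I, hI, hcard⟩ := Finset.exists_mem_eq_sup
      (Finset.univ.filter fun I : Finset (Fin m) =>
        ExtTrop.TropIndependent fun i : I => (A.map ExtTrop.real) i.1)
      ⟨∅, Finset.mem_filter.2 ⟨Finset.mem_univ _,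
        (hind ∅).2 ⟨fun _ => 0, fun j => (Finset.notMem_empty _ j.2).elim⟩⟩⟩ Finset.card
    have hrank : ExtTrop.tropicalRank (A.map ExtTrop.real) = I.card := by
      rw [← hcard]
      unfold ExtTrop.tropicalRank
      congr!
    obtain ⟨J, hJ, hdom⟩ := ((hind I).1 (Finset.mem_filter.1 hI).2).exists_rows
    rw [Fintype.card_coe] at hJ
    refine ⟨J, hJ.trans hrank.symm, ?_⟩
    rcases J.eq_empty_or_nonempty with rfl | hJne
    -- As `n > 0`, a single row is always independent, so rank 0 forces `m = 0`; the system without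
    -- equations or unknowns then has exactly one solution.
    · have hm : IsEmpty (Fin m) := by
        refine ⟨fun i => ?_⟩
        have h1 := hle {i} ⟨fun _ => 0, fun j => ⟨⟨0, hn⟩, fun l hl =>
          (hl (Subsingleton.elim _ _)).elim⟩⟩
        rw [hrank, ← hJ] at h1
        simp at h1
      exact ⟨fun _ => 0, fun _ => 0, fun i => (hm.false i).elim,
        fun y _ => funext fun j => (Finset.notMem_empty _ j.2).elim⟩
    · have : Nonempty J := hJne.to_subtype
      exact DominatedColumns.stronglyLinIndepColumns
        (DominatedColumns.of_submatrix (M := A.submatrix id (fun j : J => j.1))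
          (fun i : I => i.1) hdom)
  · rintro k ⟨J, rfl, hJ⟩
    obtain ⟨I, hI, hdom⟩ := hJ.dominatedColumns.exists_rows
    rw [Fintype.card_coe] at hI
    rw [← hI]
    exact hle I (DominatedColumns.of_submatrix
      (M := (A.submatrix (fun i : I => i.1) id).transpose) (fun j : J => j.1) hdom)
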